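/- For $\hbar>0$ let $X$ and $\Xi$ denote the position and momentum operators on $L^2(\mathbb R)$, that is, the self-adjoint operators $$Xf(x)=xf(x),\qquad \Xi f(x)=-i\hbar f'(x),$$ with domains $\{f\in L^2(\mathbb R): xf\in L^2(\mathbb R)\}$ and $\{f\in L^2(\mathbb R): f'\in L^2(\mathbb R)\}$ respectively (the derivative is taken in the sense of distributions). Consider the commutator $$C^{(1)}_\hbar=[\Pi_X,\Pi_\Xi]=\Pi_X\Pi_\Xi-\Pi_\Xi\Pi_X,\qquad \Pi_X=\mathbf 1_{(0,\infty)}(X),\quad \Pi_\Xi=\mathbf 1_{(0,\infty)}(\Xi),$$ of the spectral projections of $X$ and $\Xi$ corresponding to $(0,\infty)$. Then $C^{(1)}_\hbar\equiv C^{(1)}$ is independent of $\hbar$, and its operator norm on $L^2(\mathbb R)$ is $\Vert C^{(1)}\Vert_{\mathrm{op}}=\frac12$. -/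

import Mathlib

open MeasureTheory Set
open scoped SchwartzMap ENNReal

noncomputable section

section SpectralTheory

variable {H : Type*} [NormedAddCommGroup H] [InnerProductSpace ℂ H] [CompleteSpace H]

/-- A projection-valued measure on the Borel sets of `ℝ`, with values in the orthogonal projections
of the complex Hilbert space `H`, countably additive in the strong operator topology.
(The values at non-measurable sets carry no information.) -/
structure ProjectionValuedMeasure (H : Type*) [NormedAddCommGroup H] [InnerProductSpace ℂ H]
    [CompleteSpace H] where
  /-- The projection attached to a set. -/
  proj : Set ℝ → H →L[ℂ] H
  isStarProjection : ∀ B, MeasurableSet B → IsStarProjection (proj B)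
  proj_empty : proj ∅ = 0
  proj_univ : proj univ = 1
  proj_inter : ∀ B B', MeasurableSet B → MeasurableSet B' → proj (B ∩ B') = proj B * proj B'
  hasSum_iUnion : ∀ B : ℕ → Set ℝ, (∀ n, MeasurableSet (B n)) →
    Pairwise (Function.onFun Disjoint B) → ∀ x, HasSum (fun n => proj (B n) x) (proj (⋃ n, B n) x)

namespace ProjectionValuedMeasure

theorem re_inner_nonneg (E : ProjectionValuedMeasure H) {B : Set ℝ} (hB : MeasurableSet B) (x : H) :
    0 ≤ (inner ℂ x (E.proj B x)).re := by
  have h := E.isStarProjection B hB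
  have h1 : E.proj B x = E.proj B (E.proj B x) := by
    have := congrArg (fun T : H →L[ℂ] H => T x) h.isIdempotentElem.eq
    simpa using this.symm
  have h2 : inner ℂ x (E.proj B (E.proj B x)) = inner ℂ (E.proj B x) (E.proj B x) := by
    rw [← ContinuousLinearMap.adjoint_inner_left, h.isSelfAdjoint.adjoint_eq]
  rw [h1, h2]
  exact inner_self_nonneg (𝕜 := ℂ)

/-- The scalar spectral measure `B ↦ ⟨x, E(B) x⟩` of a vector `x`. -/
def scalarMeasure (E : ProjectionValuedMeasure H) (x : H) : Measure ℝ :=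
  Measure.ofMeasurable (fun B _ => ENNReal.ofReal (inner ℂ x (E.proj B x)).re)
    (by simp [E.proj_empty])
    (by
      intro B hB hd
      have h := ((E.hasSum_iUnion B hB hd x).mapL (innerSL ℂ x)).mapL Complex.reCLM
      simp only [innerSL_apply_apply, Complex.reCLM_apply] at h
      rw [← h.tsum_eq]
      exact ENNReal.ofReal_tsum_of_nonneg (fun n => E.re_inner_nonneg (hB n) x) h.summable)

/-- `E` is the spectral measure of the (possibly unbounded) operator `A`, i.e. `A = ∫ t dE(t)`:
the domain of `A` consists of the `x` with `∫ t² d⟨x, E(t) x⟩ < ∞`, and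
`⟨x, A x⟩ = ∫ t d⟨x, E(t) x⟩` on this domain. -/
def IsSpectralMeasureOf (E : ProjectionValuedMeasure H) (A : H →ₗ.[ℂ] H) : Prop :=
  (∀ x, x ∈ A.domain ↔ ∫⁻ t, ENNReal.ofReal (t ^ 2) ∂(E.scalarMeasure x) < ∞) ∧
  ∀ x : A.domain, inner ℂ (x : H) (A x) = ((∫ t, t ∂(E.scalarMeasure (x : H)) : ℝ) : ℂ)

end ProjectionValuedMeasure

open Classical in
/-- The spectral projection `1_B(A)` of an operator `A`: the unique operator that is the value at
`B` of a spectral measure of `A` (and `0` if `A` has no spectral measure, or if the value at `B`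
were not unique; neither occurs for self-adjoint `A` and Borel `B`). -/
def spectralProjection (A : H →ₗ.[ℂ] H) (B : Set ℝ) : H →L[ℂ] H :=
  if h : ∃! P : H →L[ℂ] H,
      ∃ E : ProjectionValuedMeasure H, E.IsSpectralMeasureOf A ∧ E.proj B = P
  then h.choose else 0

end SpectralTheory

section PositionMomentum

/-- The complex Hilbert space `L²(ℝ)`. -/
abbrev L2Line : Type := Lp ℂ 2 (volume : Measure ℝ)

/-- Pairs `(f, g)` in `L²(ℝ)` with `g(x) = x f(x)` almost everywhere. -/
def positionGraph : Submodule ℂ (L2Line × L2Line) where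
  carrier := {p | ∀ᵐ x : ℝ, p.2 x = (x : ℂ) * p.1 x}
  zero_mem' := by
    filter_upwards [Lp.coeFn_zero ℂ 2 (volume : Measure ℝ)] with x hx
    simp
  add_mem' := by
    intro p q hp hq
    filter_upwards [hp, hq, Lp.coeFn_add p.1 q.1, Lp.coeFn_add p.2 q.2] with x h1 h2 h3 h4
    simp only [Prod.fst_add, Prod.snd_add, h3, h4, Pi.add_apply, h1, h2]
    ring
  smul_mem' := by
    intro c p hp
    filter_upwards [hp, Lp.coeFn_smul c p.1, Lp.coeFn_smul c p.2] with x h1 h2 h3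
    simp only [Prod.smul_fst, Prod.smul_snd, h2, h3, Pi.smul_apply, h1, smul_eq_mul]
    ring

theorem positionGraph_functional (p : L2Line × L2Line) (hp : p ∈ positionGraph) (h0 : p.1 = 0) :
    p.2 = 0 := by
  rw [Lp.eq_zero_iff_ae_eq_zero]
  have hp' : ∀ᵐ x : ℝ, p.2 x = (x : ℂ) * p.1 x := hp
  have h1 := (Lp.eq_zero_iff_ae_eq_zero (f := p.1)).1 h0
  filter_upwards [hp', h1] with x hx hx1
  simp [hx, hx1]

/-- The position operator `X f(x) = x f(x)` on its maximal domain
`{f ∈ L²(ℝ) | x f(x) ∈ L²(ℝ)}`. -/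
def positionOp : L2Line →ₗ.[ℂ] L2Line := positionGraph.toLinearPMap

theorem positionOp_graph : positionOp.graph = positionGraph :=
  Submodule.toLinearPMap_graph_eq _ positionGraph_functional

/-- Pairs `(f, g)` in `L²(ℝ)` with `g = -iħ f'`, the derivative being taken in the sense of
(tempered) distributions. -/
def momentumGraph (hbar : ℝ) : Submodule ℂ (L2Line × L2Line) where
  carrier := {p | Lp.toTemperedDistributionCLM ℂ volume 2 p.2 =
    (-(Complex.I * (hbar : ℂ))) •
      TemperedDistribution.derivCLM ℂ (Lp.toTemperedDistributionCLM ℂ volume 2 p.1)}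
  zero_mem' := by
    simp only [mem_ofPred_eq, Prod.fst_zero, Prod.snd_zero, map_zero]
    exact (smul_zero (M := ℂ) (A := 𝓢'(ℝ, ℂ)) _).symm
  add_mem' := by
    intro p q hp hq
    simp only [mem_ofPred_eq, Prod.fst_add, Prod.snd_add, map_add, smul_add] at hp hq ⊢
    rw [hp, hq]
  smul_mem' := by
    intro c p hp
    simp only [mem_ofPred_eq, Prod.smul_fst, Prod.smul_snd, map_smul] at hp ⊢
    rw [hp, smul_comm]

theorem momentumGraph_functional (hbar : ℝ) (p : L2Line × L2Line) (hp : p ∈ momentumGraph hbar)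
    (h0 : p.1 = 0) : p.2 = 0 := by
  have hp' : Lp.toTemperedDistributionCLM ℂ volume 2 p.2 =
      (-(Complex.I * (hbar : ℂ))) •
        TemperedDistribution.derivCLM ℂ (Lp.toTemperedDistributionCLM ℂ volume 2 p.1) := hp
  rw [h0, map_zero, map_zero] at hp'
  have hk : p.2 ∈ (Lp.toTemperedDistributionCLM ℂ (volume : Measure ℝ) 2).ker :=
    hp'.trans (smul_zero (M := ℂ) (A := 𝓢'(ℝ, ℂ)) _)
  rwa [Lp.ker_toTemperedDistributionCLM_eq_bot, Submodule.mem_bot] at hk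

/-- The momentum operator `Ξ f = -iħ f'` on its maximal domain, which for `ħ ≠ 0` is the Sobolev
space `H¹(ℝ) = {f ∈ L²(ℝ) | f' ∈ L²(ℝ)}`. -/
def momentumOp (hbar : ℝ) : L2Line →ₗ.[ℂ] L2Line := (momentumGraph hbar).toLinearPMap

theorem momentumOp_graph (hbar : ℝ) : (momentumOp hbar).graph = momentumGraph hbar :=
  Submodule.toLinearPMap_graph_eq _ (momentumGraph_functional hbar)

/-- The commutator `[1_{(0,∞)}(X), 1_{(0,∞)}(Ξ)]` on `L²(ℝ)`. -/
def lineCommutator (hbar : ℝ) : L2Line →L[ℂ] L2Line :=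
  ⁅spectralProjection positionOp (Ioi 0), spectralProjection (momentumOp hbar) (Ioi 0)⁆

end PositionMomentum

end

/-!
For orthogonal projections `P` and `Q` the reflections `2P - 1` and `2Q - 1` are unitary, and
`4[P, Q]` is their commutator; hence `‖[P, Q]‖ ≤ 1/2`.

The Fourier transform turns `Ξ` into multiplication by `2πħξ`, and spectral projections of
multiplication operators are multiplications by indicator functions. So for every `ħ > 0` the
projections are `Π_X = 1_{(0,∞)}` and `Π_Ξ = 𝓕⁻¹ 1_{(0,∞)} 𝓕`, which do not involve `ħ`.

For the lower bound, let `u` be the density of the Gamma distribution of shape `a > 1/2` and rate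
`2π`, and let `v` be its reflection `v(x) = u(-x)`. Since `Π_X u = u`, `Π_X v = 0`,
`𝓕u(ξ) = (1 + iξ)⁻ᵃ` and `𝓕v(ξ) = (1 - iξ)⁻ᵃ`,
`⟨u, [Π_X, Π_Ξ] v⟩ = ∫₀^∞ (1 - iξ)⁻²ᵃ dξ = i / (2a - 1)`,
while `‖u‖ ‖v‖ = 2π Γ(2a - 1) / (Γ(a)² 2²ᵃ⁻¹)`. The modulus of the quotient is
`Γ(a)² 2²ᵃ⁻¹ / (2π Γ(2a))`, which tends to `1/2` as `a` decreases to `1/2`.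
-/

open scoped FourierTransform

noncomputable section

section CStarAlgebra

variable {𝓐 : Type*} [CStarAlgebra 𝓐] {p q : 𝓐}

theorem norm_le_one_of_mem_unitary {u : 𝓐} (hu : u ∈ unitary 𝓐) : ‖u‖ ≤ 1 := by
  nontriviality 𝓐
  exact (CStarRing.norm_of_mem_unitary hu).le

theorem norm_lie_le_two_of_mem_unitary {u v : 𝓐} (hu : u ∈ unitary 𝓐) (hv : v ∈ unitary 𝓐) :
    ‖⁅u, v⁆‖ ≤ 2 :=
  calc ‖⁅u, v⁆‖ ≤ ‖u * v‖ + ‖v * u‖ := norm_sub_le _ _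
    _ ≤ 1 + 1 := add_le_add (norm_le_one_of_mem_unitary (mul_mem hu hv))
      (norm_le_one_of_mem_unitary (mul_mem hv hu))
    _ = 2 := one_add_one_eq_two

theorem norm_lie_le_half_of_isStarProjection (hp : IsStarProjection p) (hq : IsStarProjection q) :
    ‖⁅p, q⁆‖ ≤ 1 / 2 := by
  have four_smul_lie : (4 : ℝ) • ⁅p, q⁆ = ⁅2 * p - 1, 2 * q - 1⁆ := by
    rw [Ring.lie_def, Ring.lie_def, ofNat_smul_eq_nsmul]
    noncomm_ring
  have norm_le := norm_lie_le_two_of_mem_unitary hp.two_mul_sub_one_mem_unitary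
    hq.two_mul_sub_one_mem_unitary
  rw [← four_smul_lie, norm_smul, Real.norm_ofNat] at norm_le
  linarith

end CStarAlgebra

theorem norm_inner_le_norm_lie {𝕜 V : Type*} [RCLike 𝕜] [NormedAddCommGroup V]
    [InnerProductSpace 𝕜 V] [CompleteSpace V] {p : V →L[𝕜] V} (hp : IsSelfAdjoint p)
    (q : V →L[𝕜] V) {u v : V} (hu : p u = u) (hv : p v = 0) :
    ‖inner 𝕜 u (q v)‖ ≤ ‖⁅p, q⁆‖ * (‖u‖ * ‖v‖) := by
  have inner_lie : inner 𝕜 u (⁅p, q⁆ v) = inner 𝕜 u (q v) := by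
    rw [Ring.lie_def, sub_apply, mul_apply_eq_comp, mul_apply_eq_comp, hv, map_zero, sub_zero,
      ← ContinuousLinearMap.coe_coe p, ← hp.isSymmetric u, ContinuousLinearMap.coe_coe, hu]
  calc ‖inner 𝕜 u (q v)‖ ≤ ‖u‖ * ‖⁅p, q⁆ v‖ := inner_lie ▸ norm_inner_le_norm u _
    _ ≤ ‖u‖ * (‖⁅p, q⁆‖ * ‖v‖) := by gcongr; exact ⁅p, q⁆.le_opNorm v
    _ = ‖⁅p, q⁆‖ * (‖u‖ * ‖v‖) := by ring

section SpectralMeasure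

theorem ext_inner_self {V : Type*} [NormedAddCommGroup V] [InnerProductSpace ℂ V] {S T : V →L[ℂ] V}
    (h : ∀ x, inner ℂ x (S x) = inner ℂ x (T x)) : S = T :=
  ContinuousLinearMap.coe_injective <| (ext_inner_map _ _).1 fun x => by
    rw [← inner_conj_symm, ← inner_conj_symm (𝕜 := ℂ) _ x]
    exact congrArg (starRingEnd ℂ) (h x)

variable {H : Type*} [NormedAddCommGroup H] [InnerProductSpace ℂ H] [CompleteSpace H]

theorem iUnion_Icc_add_eq_Ioi (c : ℝ) :
    ⋃ n : ℕ, Icc (c + 1 / (n + 1)) (c + n) = Ioi c := by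
  ext t
  simp only [mem_iUnion, mem_Icc, mem_Ioi]
  refine ⟨fun ⟨n, hn, _⟩ => lt_of_lt_of_le (lt_add_of_pos_right c (by positivity)) hn, fun ht => ?_⟩
  obtain ⟨m, hm⟩ := exists_nat_one_div_lt (sub_pos.2 ht)
  obtain ⟨k, hk⟩ := exists_nat_ge (t - c)
  have : (1 : ℝ) / ((max m k : ℕ) + 1) ≤ 1 / (m + 1) := by gcongr; exact le_max_left m k
  have : (k : ℝ) ≤ (max m k : ℕ) := by gcongr; exact le_max_right m k
  exact ⟨max m k, by linarith, by linarith⟩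

namespace ProjectionValuedMeasure

variable (E : ProjectionValuedMeasure H)

theorem proj_proj {B C : Set ℝ} (hB : MeasurableSet B) (hC : MeasurableSet C) (x : H) :
    E.proj B (E.proj C x) = E.proj (B ∩ C) x := by
  rw [E.proj_inter B C hB hC, mul_apply_eq_comp]

theorem proj_comm {B C : Set ℝ} (hB : MeasurableSet B) (hC : MeasurableSet C) (x : H) :
    E.proj B (E.proj C x) = E.proj C (E.proj B x) := by
  rw [E.proj_proj hB hC, E.proj_proj hC hB, inter_comm]

theorem inner_proj_left {B : Set ℝ} (hB : MeasurableSet B) (x y : H) :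
    inner ℂ (E.proj B x) y = inner ℂ x (E.proj B y) :=
  (E.isStarProjection B hB).isSelfAdjoint.isSymmetric x y

theorem inner_proj_self {B : Set ℝ} (hB : MeasurableSet B) (x : H) :
    inner ℂ x (E.proj B x) = ((‖E.proj B x‖ ^ 2 : ℝ) : ℂ) := by
  have proj_self : E.proj B x = E.proj B (E.proj B x) := by rw [E.proj_proj hB hB, inter_self]
  rw [proj_self, ← E.inner_proj_left hB, ← proj_self, inner_self_eq_norm_sq_to_K]
  norm_cast

theorem scalarMeasure_apply {B : Set ℝ} (hB : MeasurableSet B) (x : H) :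
    E.scalarMeasure x B = ENNReal.ofReal (‖E.proj B x‖ ^ 2) := by
  rw [scalarMeasure, Measure.ofMeasurable_apply B hB, E.inner_proj_self hB, Complex.ofReal_re]

instance isFiniteMeasure_scalarMeasure (x : H) : IsFiniteMeasure (E.scalarMeasure x) :=
  ⟨by rw [E.scalarMeasure_apply .univ]; exact ENNReal.ofReal_lt_top⟩

theorem scalarMeasure_real_apply {B : Set ℝ} (hB : MeasurableSet B) (x : H) :
    (E.scalarMeasure x).real B = ‖E.proj B x‖ ^ 2 := by
  rw [Measure.real, E.scalarMeasure_apply hB, ENNReal.toReal_ofReal (sq_nonneg _)]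

theorem scalarMeasure_real_univ (x : H) : (E.scalarMeasure x).real univ = ‖x‖ ^ 2 := by
  rw [E.scalarMeasure_real_apply .univ, E.proj_univ, one_apply_eq_self]

theorem inner_proj_eq_scalarMeasure_real {B : Set ℝ} (hB : MeasurableSet B) (x : H) :
    inner ℂ x (E.proj B x) = ((E.scalarMeasure x).real B : ℂ) := by
  rw [E.scalarMeasure_real_apply hB, E.inner_proj_self hB]

theorem scalarMeasure_eq_zero_iff {B : Set ℝ} (hB : MeasurableSet B) (x : H) :
    E.scalarMeasure x B = 0 ↔ E.proj B x = 0 := by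
  rw [E.scalarMeasure_apply hB, ENNReal.ofReal_eq_zero, sq_nonpos_iff, norm_eq_zero]

theorem proj_iUnion_apply_eq_zero {ι : Type*} [Countable ι] {B : ι → Set ℝ}
    (hB : ∀ i, MeasurableSet (B i)) {x : H} (hx : ∀ i, E.proj (B i) x = 0) :
    E.proj (⋃ i, B i) x = 0 := by
  rw [← E.scalarMeasure_eq_zero_iff (.iUnion hB), measure_iUnion_null_iff]
  exact fun i => (E.scalarMeasure_eq_zero_iff (hB i) x).2 (hx i)

theorem eq_zero_of_forall_proj_Icc_eq_zero {x : H}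
    (hx : ∀ n : ℕ, E.proj (Icc (-n : ℝ) n) x = 0) : x = 0 := by
  have iUnion_Icc : (⋃ n : ℕ, Icc (-n : ℝ) n) = univ := by
    refine eq_univ_of_forall fun t => mem_iUnion.2 ?_
    obtain ⟨n, hn⟩ := exists_nat_ge |t|
    exact ⟨n, abs_le.1 hn⟩
  simpa [iUnion_Icc, E.proj_univ] using
    E.proj_iUnion_apply_eq_zero (fun _ : ℕ => measurableSet_Icc) hx

theorem scalarMeasure_proj {B : Set ℝ} (hB : MeasurableSet B) (x : H) :
    E.scalarMeasure (E.proj B x) = (E.scalarMeasure x).restrict B := by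
  ext C hC
  rw [Measure.restrict_apply hC, E.scalarMeasure_apply hC, E.scalarMeasure_apply (hC.inter hB),
    E.proj_proj hC hB]

theorem proj_compl {B : Set ℝ} (hB : MeasurableSet B) : E.proj Bᶜ = 1 - E.proj B := by
  refine ext_inner_self fun x => ?_
  rw [E.inner_proj_eq_scalarMeasure_real hB.compl, measureReal_compl hB, E.scalarMeasure_real_univ,
    sub_apply, one_apply_eq_self, inner_sub_right, E.inner_proj_eq_scalarMeasure_real hB,
    inner_self_eq_norm_sq_to_K, Complex.ofReal_sub, Complex.ofReal_pow]
  rfl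

theorem proj_apply_add_proj_compl_apply {B : Set ℝ} (hB : MeasurableSet B) (x : H) :
    E.proj B x + E.proj Bᶜ x = x := by
  rw [E.proj_compl hB, sub_apply, one_apply_eq_self,
    add_sub_cancel]

theorem scalarMeasure_add {B : Set ℝ} (hB : MeasurableSet B) {u v : H} (hu : E.proj B u = u)
    (hv : E.proj B v = 0) :
    E.scalarMeasure (u + v) = E.scalarMeasure u + E.scalarMeasure v := by
  ext C hC
  have orthogonal : inner ℂ (E.proj C u) (E.proj C v) = 0 := by
    rw [← hu, E.proj_comm hC hB, E.inner_proj_left hB, E.proj_comm hB hC, hv, map_zero,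
      inner_zero_right]
  rw [Measure.add_apply, E.scalarMeasure_apply hC, E.scalarMeasure_apply hC,
    E.scalarMeasure_apply hC, ← ENNReal.ofReal_add (sq_nonneg _) (sq_nonneg _), map_add, sq, sq, sq,
    norm_add_sq_eq_norm_sq_add_norm_sq_of_inner_eq_zero _ _ orthogonal]

namespace IsSpectralMeasureOf

variable {E E' : ProjectionValuedMeasure H} {A : H →ₗ.[ℂ] H} {B : Set ℝ} {a b c : ℝ}

theorem proj_mem_domain (h : E.IsSpectralMeasureOf A) (hB : MeasurableSet B) (x : A.domain) :
    E.proj B x ∈ A.domain := by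
  rw [h.1, E.scalarMeasure_proj hB]
  exact (lintegral_mono' Measure.restrict_le_self le_rfl).trans_lt ((h.1 x).1 x.2)

theorem proj_Icc_mem_domain (h : E.IsSpectralMeasureOf A) (a b : ℝ) (x : H) :
    E.proj (Icc a b) x ∈ A.domain := by
  rw [h.1, E.scalarMeasure_proj measurableSet_Icc]
  refine setLIntegral_lt_top_of_le_nnreal (measure_ne_top _ _) ⟨(max |a| |b| ^ 2).toNNReal, ?_⟩
  intro t ht
  refine ENNReal.ofReal_le_ofReal ?_
  rw [← sq_abs]
  gcongr
  exact abs_le_max_abs_abs ht.1 ht.2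

theorem integrable_id (h : E.IsSpectralMeasureOf A) (x : A.domain) :
    Integrable (fun t => t) (E.scalarMeasure (x : H)) := by
  refine MemLp.integrable one_le_two ((memLp_two_iff_integrable_sq (by fun_prop)).2 ?_)
  refine ⟨by fun_prop, ?_⟩
  rw [hasFiniteIntegral_iff_ofReal (ae_of_all _ fun t => sq_nonneg t)]
  exact (h.1 x).1 x.2

/-- Polarization: the scalar measures of `u + v` and `u + I • v` are sums, hence so are the values
of the quadratic form of `A` there. -/
theorem inner_apply_eq_zero (h : E.IsSpectralMeasureOf A) (hB : MeasurableSet B) {u v : A.domain}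
    (hu : E.proj B u = u) (hv : E.proj B v = 0) : inner ℂ (u : H) (A v) = 0 := by
  have cross_terms (w : A.domain) (hw : E.proj B w = 0) :
      inner ℂ (u : H) (A w) + inner ℂ (w : H) (A u) = 0 := by
    have form_add := h.2 (u + w)
    rw [Submodule.coe_add, E.scalarMeasure_add hB hu hw,
      integral_add_measure (h.integrable_id u) (h.integrable_id w), A.map_add,
      Complex.ofReal_add, ← h.2 u, ← h.2 w, inner_add_left, inner_add_right,
      inner_add_right] at form_add
    linear_combination form_add
  have cross_terms_I := cross_terms (Complex.I • v) (by simp [hv])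
  rw [A.map_smul, Submodule.coe_smul, inner_smul_right, inner_smul_left,
    Complex.conj_I] at cross_terms_I
  have : Complex.I * (2 * inner ℂ (u : H) (A v)) = 0 := by
    linear_combination cross_terms_I + Complex.I * cross_terms v hv
  simpa using this

theorem proj_apply_eq_zero (h : E.IsSpectralMeasureOf A) (hB : MeasurableSet B) {v : A.domain}
    (hv : E.proj B v = 0) : E.proj B (A v) = 0 := by
  refine E.eq_zero_of_forall_proj_Icc_eq_zero fun n => ?_
  have hBI := hB.inter (measurableSet_Icc (a := (-n : ℝ)) (b := n))
  let u : A.domain := ⟨_, h.proj_mem_domain hB ⟨_, h.proj_Icc_mem_domain (-n : ℝ) n (A v)⟩⟩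
  have orthogonal : inner ℂ (u : H) (A v) = 0 :=
    h.inner_apply_eq_zero hB (by rw [E.proj_proj hB hB, inter_self]) hv
  simp only [u] at orthogonal
  rw [E.proj_proj hB measurableSet_Icc, E.inner_proj_left hBI, E.inner_proj_self hBI] at orthogonal
  rw [E.proj_comm measurableSet_Icc hB, E.proj_proj hB measurableSet_Icc]
  simpa using orthogonal

theorem proj_apply (h : E.IsSpectralMeasureOf A) (hB : MeasurableSet B) (x : A.domain) :
    E.proj B (A x) = A ⟨E.proj B x, h.proj_mem_domain hB x⟩ := by
  set x₁ : A.domain := ⟨E.proj B x, h.proj_mem_domain hB x⟩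
  set x₂ : A.domain := ⟨E.proj Bᶜ x, h.proj_mem_domain hB.compl x⟩
  have proj_A_x₂ : E.proj B (A x₂) = 0 := h.proj_apply_eq_zero hB <| by
    rw [E.proj_proj hB hB.compl, inter_compl_self, E.proj_empty, zero_apply]
  have proj_compl_A_x₁ : E.proj Bᶜ (A x₁) = 0 := h.proj_apply_eq_zero hB.compl <| by
    rw [E.proj_proj hB.compl hB, compl_inter_self, E.proj_empty, zero_apply]
  have hx : x = x₁ + x₂ := Subtype.ext (E.proj_apply_add_proj_compl_apply hB x).symm
  calc E.proj B (A x) = E.proj B (A x₁) + E.proj Bᶜ (A x₁) := by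
        rw [hx, A.map_add, map_add, proj_A_x₂, proj_compl_A_x₁]
    _ = A x₁ := E.proj_apply_add_proj_compl_apply hB _

/-- The truncation `A E([a, b])` of an operator `A` with spectral measure `E`, which is defined on
all of `H`. -/
def truncation (h : E.IsSpectralMeasureOf A) (a b : ℝ) : H →ₗ[ℂ] H :=
  A.toFun ∘ₗ (E.proj (Icc a b)).toLinearMap.codRestrict A.domain (h.proj_Icc_mem_domain a b)

theorem truncation_apply (h : E.IsSpectralMeasureOf A) (a b : ℝ) (x : H) :
    h.truncation a b x = A ⟨E.proj (Icc a b) x, h.proj_Icc_mem_domain a b x⟩ :=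
  rfl

theorem proj_Icc_truncation (h : E.IsSpectralMeasureOf A) (a b : ℝ) (x : H) :
    E.proj (Icc a b) (h.truncation a b x) = h.truncation a b x := by
  rw [truncation_apply, h.proj_apply measurableSet_Icc]
  simp only [E.proj_proj measurableSet_Icc measurableSet_Icc, inter_self]

theorem inner_truncation_self (h : E.IsSpectralMeasureOf A) (a b : ℝ) (x : H) :
    inner ℂ x (h.truncation a b x) = ((∫ t in Icc a b, t ∂E.scalarMeasure x : ℝ) : ℂ) := by
  rw [← h.proj_Icc_truncation, ← E.inner_proj_left measurableSet_Icc, truncation_apply,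
    ← E.scalarMeasure_proj measurableSet_Icc]
  exact h.2 ⟨_, h.proj_Icc_mem_domain a b x⟩

theorem isSymmetric_truncation (h : E.IsSpectralMeasureOf A) (a b : ℝ) :
    (h.truncation a b).IsSymmetric := by
  rw [LinearMap.isSymmetric_iff_inner_map_self_real]
  intro x
  rw [inner_conj_symm, ← inner_conj_symm (h.truncation a b x), h.inner_truncation_self,
    Complex.conj_ofReal]

/-- The bounded operator `(A - a) E([a, b])`. -/
def shiftedTruncation (h : E.IsSpectralMeasureOf A) (a b : ℝ) : H →L[ℂ] H :=
  ⟨h.truncation a b, (h.isSymmetric_truncation a b).continuous⟩ - (a : ℂ) • E.proj (Icc a b)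

theorem shiftedTruncation_apply (h : E.IsSpectralMeasureOf A) (a b : ℝ) (x : H) :
    h.shiftedTruncation a b x = h.truncation a b x - (a : ℂ) • E.proj (Icc a b) x :=
  rfl

theorem inner_shiftedTruncation_self (h : E.IsSpectralMeasureOf A) (a b : ℝ) (x : H) :
    inner ℂ x (h.shiftedTruncation a b x) =
      ((∫ t in Icc a b, (t - a) ∂E.scalarMeasure x : ℝ) : ℂ) := by
  have integrable : IntegrableOn (fun t => t) (Icc a b) (E.scalarMeasure x) :=
    continuous_id.continuousOn.integrableOn_Icc
  rw [integral_sub integrable integrableOn_const, setIntegral_const, shiftedTruncation_apply,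
    inner_sub_right, h.inner_truncation_self, inner_smul_right,
    E.inner_proj_eq_scalarMeasure_real measurableSet_Icc, smul_eq_mul, mul_comm]
  push_cast
  rfl

theorem shiftedTruncation_nonneg (h : E.IsSpectralMeasureOf A) (a b : ℝ) :
    0 ≤ h.shiftedTruncation a b := by
  rw [ContinuousLinearMap.nonneg_iff_isPositive, ContinuousLinearMap.isPositive_iff_complex]
  intro x
  rw [← inner_conj_symm, h.inner_shiftedTruncation_self, Complex.conj_ofReal]
  exact ⟨rfl, setIntegral_nonneg measurableSet_Icc fun t ht => sub_nonneg.2 ht.1⟩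

theorem shiftedTruncation_proj_Icc (h : E.IsSpectralMeasureOf A) (a b : ℝ) (x : H) :
    h.shiftedTruncation a b (E.proj (Icc a b) x) = h.shiftedTruncation a b x := by
  simp only [shiftedTruncation_apply, truncation_apply, E.proj_proj measurableSet_Icc
    measurableSet_Icc, inter_self]

theorem proj_Icc_shiftedTruncation (h : E.IsSpectralMeasureOf A) (a b : ℝ) (x : H) :
    E.proj (Icc a b) (h.shiftedTruncation a b x) = h.shiftedTruncation a b x := by
  rw [shiftedTruncation_apply, map_sub, map_smul, h.proj_Icc_truncation,
    E.proj_proj measurableSet_Icc measurableSet_Icc, inter_self]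

theorem proj_shiftedTruncation (h : E.IsSpectralMeasureOf A) (h' : E'.IsSpectralMeasureOf A)
    (hB : MeasurableSet B) (a b : ℝ) (x : H) :
    E'.proj B (h.shiftedTruncation a b x) =
      A ⟨E'.proj B (E.proj (Icc a b) x), h'.proj_mem_domain hB ⟨_, h.proj_Icc_mem_domain a b x⟩⟩ -
        (a : ℂ) • E'.proj B (E.proj (Icc a b) x) := by
  rw [shiftedTruncation_apply, map_sub, map_smul, truncation_apply, h'.proj_apply hB]

theorem commute_shiftedTruncation (h : E.IsSpectralMeasureOf A) (h' : E'.IsSpectralMeasureOf A)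
    (hB : MeasurableSet B) (a b : ℝ) :
    Commute (E.proj (Icc a b) * E'.proj B * E.proj (Icc a b)) (h.shiftedTruncation a b) := by
  ext x
  simp only [mul_apply_eq_comp]
  rw [h.proj_Icc_shiftedTruncation, h.proj_shiftedTruncation h' hB, h.shiftedTruncation_proj_Icc,
    shiftedTruncation_apply, map_sub, map_smul, h.proj_apply measurableSet_Icc, truncation_apply]

theorem inner_conjugate_mul_shiftedTruncation (h : E.IsSpectralMeasureOf A)
    (hB : MeasurableSet B) (a b : ℝ) (x : H) :
    inner ℂ x ((E.proj (Icc a b) * E'.proj B * E.proj (Icc a b) * h.shiftedTruncation a b) x) =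
      inner ℂ (E'.proj B (E.proj (Icc a b) x)) (E'.proj B (h.shiftedTruncation a b x)) := by
  simp only [mul_apply_eq_comp]
  rw [← E.inner_proj_left measurableSet_Icc, h.proj_Icc_shiftedTruncation, E'.inner_proj_left hB,
    E'.proj_proj hB hB, inter_self]

theorem integral_scalarMeasure_le (h : E.IsSpectralMeasureOf A) {x : A.domain}
    (hx : E.proj (Iic c) x = x) : ∫ t, t ∂E.scalarMeasure (x : H) ≤ c * ‖(x : H)‖ ^ 2 := by
  have ae_le : ∀ᵐ t ∂E.scalarMeasure (x : H), t ≤ c := by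
    rw [← hx, E.scalarMeasure_proj measurableSet_Iic]
    exact ae_restrict_mem measurableSet_Iic
  calc ∫ t, t ∂E.scalarMeasure (x : H) ≤ ∫ _, c ∂E.scalarMeasure (x : H) :=
        integral_mono_ae (h.integrable_id x) (integrable_const c) ae_le
    _ = c * ‖(x : H)‖ ^ 2 := by
        rw [integral_const, E.scalarMeasure_real_univ, smul_eq_mul, mul_comm]

/-- The operator `E([a, b]) E'((-∞, c]) E([a, b])` commutes with `(A - a) E([a, b])`, so the
product of these two positive operators is positive. But its quadratic form at `x` is that of
`A - a` at `E'((-∞, c]) E([a, b]) x`, where `A - a ≤ c - a < 0`. -/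
theorem proj_Iic_proj_Icc_eq_zero (h : E.IsSpectralMeasureOf A) (h' : E'.IsSpectralMeasureOf A)
    (hca : c < a) (x : H) : E'.proj (Iic c) (E.proj (Icc a b) x) = 0 := by
  have hI : MeasurableSet (Icc a b) := measurableSet_Icc
  have hJ : MeasurableSet (Iic c) := measurableSet_Iic
  set G := E.proj (Icc a b) * E'.proj (Iic c) * E.proj (Icc a b)
  set z : A.domain :=
    ⟨E'.proj (Iic c) (E.proj (Icc a b) x), h'.proj_mem_domain hJ ⟨_, h.proj_Icc_mem_domain a b x⟩⟩
  have product_nonneg : 0 ≤ G * h.shiftedTruncation a b :=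
    (h.commute_shiftedTruncation h' hJ a b).mul_nonneg
      ((E.isStarProjection _ hI).isSelfAdjoint.conjugate_nonneg (E'.isStarProjection _ hJ).nonneg)
      (h.shiftedTruncation_nonneg a b)
  have form_eq : inner ℂ x ((G * h.shiftedTruncation a b) x) =
      ((∫ t, t ∂E'.scalarMeasure (z : H) - a * ‖(z : H)‖ ^ 2 : ℝ) : ℂ) := by
    rw [h.inner_conjugate_mul_shiftedTruncation hJ, h.proj_shiftedTruncation h' hJ,
      inner_sub_right, inner_smul_right, h'.2 z, inner_self_eq_norm_sq_to_K]
    push_cast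
    rfl
  have form_nonneg : 0 ≤ ∫ t, t ∂E'.scalarMeasure (z : H) - a * ‖(z : H)‖ ^ 2 := by
    have := ((ContinuousLinearMap.nonneg_iff_isPositive _).1 product_nonneg).re_inner_nonneg_right x
    rwa [form_eq, RCLike.re_to_complex, Complex.ofReal_re] at this
  have form_le := h'.integral_scalarMeasure_le (x := z) (c := c)
    (by simp only [z, E'.proj_proj hJ hJ, inter_self])
  have norm_sq_nonpos : ‖(z : H)‖ ^ 2 ≤ 0 := by nlinarith
  exact norm_eq_zero.1 (sq_nonpos_iff _ |>.1 norm_sq_nonpos)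

theorem proj_Ioi_mul_proj_Iic (h : E.IsSpectralMeasureOf A) (h' : E'.IsSpectralMeasureOf A)
    (c : ℝ) : E.proj (Ioi c) * E'.proj (Iic c) = 0 := by
  ext x
  rw [mul_apply_eq_comp, zero_apply, ← iUnion_Icc_add_eq_Ioi]
  refine E.proj_iUnion_apply_eq_zero (fun _ => measurableSet_Icc) fun n => ?_
  refine ext_inner_left ℂ fun y => ?_
  rw [← E.inner_proj_left measurableSet_Icc, ← E'.inner_proj_left measurableSet_Iic,
    h.proj_Iic_proj_Icc_eq_zero h' (lt_add_of_pos_right c (by positivity)), inner_zero_left,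
    inner_zero_right]

theorem proj_Iic_eq (h : E.IsSpectralMeasureOf A) (h' : E'.IsSpectralMeasureOf A) (c : ℝ) :
    E.proj (Iic c) = E'.proj (Iic c) := by
  have proj_Iic_mul {F F' : ProjectionValuedMeasure H} (hF : F.IsSpectralMeasureOf A)
      (hF' : F'.IsSpectralMeasureOf A) : F.proj (Iic c) * F'.proj (Iic c) = F'.proj (Iic c) := by
    have := hF.proj_Ioi_mul_proj_Iic hF' c
    rwa [← compl_Iic, F.proj_compl measurableSet_Iic, sub_mul, one_mul, sub_eq_zero,
      eq_comm] at this
  have star_proj (F : ProjectionValuedMeasure H) : star (F.proj (Iic c)) = F.proj (Iic c) :=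
    (F.isStarProjection _ measurableSet_Iic).isSelfAdjoint.star_eq
  calc E.proj (Iic c) = E'.proj (Iic c) * E.proj (Iic c) := (proj_Iic_mul h' h).symm
    _ = star (E.proj (Iic c) * E'.proj (Iic c)) := by rw [star_mul, star_proj, star_proj]
    _ = E'.proj (Iic c) := by rw [proj_Iic_mul h h', star_proj]

theorem proj_eq (h : E.IsSpectralMeasureOf A) (h' : E'.IsSpectralMeasureOf A)
    (hB : MeasurableSet B) : E.proj B = E'.proj B := by
  refine ext_inner_self fun x => ?_
  have scalarMeasure_eq : E.scalarMeasure x = E'.scalarMeasure x :=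
    Measure.ext_of_Iic _ _ fun c => by
      rw [E.scalarMeasure_apply measurableSet_Iic, h.proj_Iic_eq h',
        E'.scalarMeasure_apply measurableSet_Iic]
  rw [E.inner_proj_eq_scalarMeasure_real hB, scalarMeasure_eq,
    E'.inner_proj_eq_scalarMeasure_real hB]

theorem spectralProjection_eq (h : E.IsSpectralMeasureOf A) (hB : MeasurableSet B) :
    spectralProjection A B = E.proj B := by
  have existsUnique : ∃! P : H →L[ℂ] H,
      ∃ E : ProjectionValuedMeasure H, E.IsSpectralMeasureOf A ∧ E.proj B = P := by
    refine ⟨_, ⟨E, h, rfl⟩, ?_⟩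
    rintro _ ⟨E', h', rfl⟩
    exact h'.proj_eq h hB
  rw [spectralProjection, dif_pos existsUnique]
  obtain ⟨E', h', proj_eq_choose⟩ := existsUnique.choose_spec.1
  rw [← proj_eq_choose, h'.proj_eq h hB]

end IsSpectralMeasureOf

end ProjectionValuedMeasure

end SpectralMeasure

section MultiplicationOperators

theorem norm_sub_sum_sq_of_orthogonal {𝕜 ι V : Type*} [RCLike 𝕜] [NormedAddCommGroup V]
    [InnerProductSpace 𝕜 V] {v : ι → V} {w : V} (hv : Pairwise fun i j => inner 𝕜 (v i) (v j) = 0)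
    (hw : ∀ i, inner 𝕜 w (v i) = ((‖v i‖ ^ 2 : ℝ) : 𝕜)) (s : Finset ι) :
    ‖w - ∑ i ∈ s, v i‖ ^ 2 = ‖w‖ ^ 2 - ∑ i ∈ s, ‖v i‖ ^ 2 := by
  have inner_sum_right : inner 𝕜 w (∑ i ∈ s, v i) = ((∑ i ∈ s, ‖v i‖ ^ 2 : ℝ) : 𝕜) := by
    simp only [inner_sum, hw, RCLike.ofReal_sum]
  have inner_sum_self : inner 𝕜 (∑ i ∈ s, v i) (∑ i ∈ s, v i) =
      ((∑ i ∈ s, ‖v i‖ ^ 2 : ℝ) : 𝕜) := by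
    rw [sum_inner, RCLike.ofReal_sum]
    refine Finset.sum_congr rfl fun i hi => ?_
    rw [inner_sum, Finset.sum_eq_single_of_mem i hi fun j _ hj => hv hj.symm,
      inner_self_eq_norm_sq_to_K, RCLike.ofReal_pow]
  rw [norm_sub_sq (𝕜 := 𝕜), inner_sum_right, ← inner_self_eq_norm_sq (𝕜 := 𝕜) (∑ i ∈ s, v i),
    inner_sum_self, RCLike.ofReal_re]
  ring

theorem hasSum_of_orthogonal {𝕜 ι V : Type*} [RCLike 𝕜] [NormedAddCommGroup V]
    [InnerProductSpace 𝕜 V] {v : ι → V} {w : V} (hv : Pairwise fun i j => inner 𝕜 (v i) (v j) = 0)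
    (hw : ∀ i, inner 𝕜 w (v i) = ((‖v i‖ ^ 2 : ℝ) : 𝕜))
    (parseval : HasSum (fun i => ‖v i‖ ^ 2) (‖w‖ ^ 2)) : HasSum v w := by
  rw [HasSum, SummationFilter.unconditional_filter, tendsto_iff_norm_sub_tendsto_zero]
  have norm_sq_tendsto : Filter.Tendsto (fun s : Finset ι => ‖w - ∑ i ∈ s, v i‖ ^ 2) Filter.atTop
      (nhds 0) := by
    simp only [norm_sub_sum_sq_of_orthogonal hv hw]
    exact sub_self (‖w‖ ^ 2) ▸ tendsto_const_nhds.sub parseval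
  simpa only [Real.sqrt_sq (norm_nonneg _), Real.sqrt_zero, norm_sub_rev w] using
    norm_sq_tendsto.sqrt

variable {α : Type*} [MeasurableSpace α] {μ : Measure α} {B C : Set α}

open Classical in
/-- Multiplication by the indicator function of `B` on `L²(μ)`, with the junk value `0` if `B` is
not measurable. -/
def indicatorMul (μ : Measure α) (B : Set α) : Lp ℂ 2 μ →L[ℂ] Lp ℂ 2 μ :=
  if hB : MeasurableSet B then
    (ContinuousLinearMap.mul ℂ ℂ).holderL μ ∞ 2 2
      (((memLp_top_const (1 : ℂ)).indicator hB).toLp (B.indicator fun _ => 1))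
  else 0

theorem coeFn_indicatorMul (hB : MeasurableSet B) (f : Lp ℂ 2 μ) :
    indicatorMul μ B f =ᵐ[μ] B.indicator f := by
  rw [indicatorMul, dif_pos hB, ContinuousLinearMap.holderL_apply_apply]
  refine (ContinuousLinearMap.coeFn_holder _ _ f).trans ?_
  filter_upwards [((memLp_top_const (1 : ℂ)).indicator hB).coeFn_toLp (μ := μ)] with x hx
  rw [hx, ContinuousLinearMap.mul_apply', ← indicator_mul_left]
  simp only [one_mul]

theorem inner_indicatorMul (hB : MeasurableSet B) (f g : Lp ℂ 2 μ) :
    inner ℂ f (indicatorMul μ B g) = ∫ x in B, inner ℂ (f x) (g x) ∂μ := by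
  rw [L2.inner_def, ← integral_indicator hB]
  refine integral_congr_ae ?_
  filter_upwards [coeFn_indicatorMul hB g] with x hx
  rw [hx]
  by_cases h : x ∈ B <;> simp [h]

theorem indicatorMul_inter (hB : MeasurableSet B) (hC : MeasurableSet C) :
    indicatorMul μ (B ∩ C) = indicatorMul μ B * indicatorMul μ C := by
  ext f
  filter_upwards [coeFn_indicatorMul hC f, coeFn_indicatorMul hB (indicatorMul μ C f),
    coeFn_indicatorMul (hB.inter hC) f] with x hC hBC hinter
  rw [mul_apply_eq_comp, hBC, hinter, ← indicator_indicator]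
  by_cases h : x ∈ B <;> simp [h, hC]

theorem indicatorMul_empty : indicatorMul μ ∅ = 0 := by
  ext f
  filter_upwards [coeFn_indicatorMul .empty f, Lp.coeFn_zero ℂ 2 μ] with x hx h0
  rw [hx, indicator_empty, zero_apply, h0, Pi.zero_apply]

theorem indicatorMul_univ : indicatorMul μ univ = 1 := by
  ext f
  filter_upwards [coeFn_indicatorMul .univ f] with x hx
  rw [hx, indicator_univ, one_apply_eq_self]

theorem indicatorMul_eq_self {f : Lp ℂ 2 μ} (hB : MeasurableSet B)
    (hf : ∀ᵐ x ∂μ, x ∉ B → f x = 0) :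
    indicatorMul μ B f = f := by
  ext1
  filter_upwards [coeFn_indicatorMul hB f, hf] with x hx h0
  rw [hx, indicator_apply_eq_self]
  exact h0

theorem indicatorMul_eq_zero {f : Lp ℂ 2 μ} (hB : MeasurableSet B)
    (hf : ∀ᵐ x ∂μ, x ∈ B → f x = 0) :
    indicatorMul μ B f = 0 := by
  ext1
  filter_upwards [coeFn_indicatorMul hB f, hf, Lp.coeFn_zero ℂ 2 μ] with x hx h0 hzero
  rw [hx, hzero, Pi.zero_apply, indicator_apply_eq_zero]
  exact h0

theorem isStarProjection_indicatorMul (hB : MeasurableSet B) :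
    IsStarProjection (indicatorMul μ B) where
  isIdempotentElem := by rw [IsIdempotentElem, ← indicatorMul_inter hB hB, inter_self]
  isSelfAdjoint := by
    rw [ContinuousLinearMap.isSelfAdjoint_iff_isSymmetric]
    intro f g
    rw [ContinuousLinearMap.coe_coe, inner_indicatorMul hB, ← inner_conj_symm,
      inner_indicatorMul hB, ← integral_conj]
    simp only [inner_conj_symm]

theorem inner_indicatorMul_indicatorMul (hB : MeasurableSet B) (hC : MeasurableSet C)
    (f : Lp ℂ 2 μ) :
    inner ℂ (indicatorMul μ B f) (indicatorMul μ C f) = inner ℂ f (indicatorMul μ (B ∩ C) f) := by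
  rw [indicatorMul_inter hB hC, mul_apply_eq_comp]
  exact (isStarProjection_indicatorMul hB).isSelfAdjoint.isSymmetric _ _

theorem lintegral_enorm_sq (f : Lp ℂ 2 μ) : ∫⁻ x, ‖f x‖ₑ ^ 2 ∂μ = ENNReal.ofReal (‖f‖ ^ 2) := by
  rw [ENNReal.ofReal_pow (norm_nonneg _), ofReal_norm, Lp.enorm_def]
  have := eLpNorm_nnreal_pow_eq_lintegral (f := f) (μ := μ) (p := 2) two_ne_zero
  simpa using this.symm

theorem norm_sq_toLp {g : α → ℂ} (hg : MemLp g 2 μ) :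
    ‖hg.toLp g‖ ^ 2 = ∫ x, ‖g x‖ ^ 2 ∂μ := by
  rw [← ENNReal.toReal_ofReal (sq_nonneg ‖hg.toLp g‖), ← lintegral_enorm_sq,
    integral_eq_lintegral_of_nonneg_ae (ae_of_all _ fun _ => sq_nonneg _) (hg.1.norm.pow 2)]
  refine congrArg ENNReal.toReal (lintegral_congr_ae ?_)
  filter_upwards [hg.coeFn_toLp] with x hx
  rw [hx, ENNReal.ofReal_pow (norm_nonneg _), ofReal_norm]

theorem withDensity_enorm_sq_apply (hB : MeasurableSet B) (f : Lp ℂ 2 μ) :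
    μ.withDensity (fun x => ‖f x‖ₑ ^ 2) B = ENNReal.ofReal (‖indicatorMul μ B f‖ ^ 2) := by
  rw [withDensity_apply _ hB, ← lintegral_enorm_sq, ← lintegral_indicator hB]
  refine lintegral_congr_ae ?_
  filter_upwards [coeFn_indicatorMul hB f] with x hx
  rw [hx]
  by_cases h : x ∈ B <;> simp [h]

theorem hasSum_indicatorMul_iUnion {B : ℕ → Set α} (hB : ∀ n, MeasurableSet (B n))
    (disjoint : Pairwise (Function.onFun Disjoint B)) (f : Lp ℂ 2 μ) :
    HasSum (fun n => indicatorMul μ (B n) f) (indicatorMul μ (⋃ n, B n) f) := by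
  have hU := MeasurableSet.iUnion hB
  refine hasSum_of_orthogonal (𝕜 := ℂ) (fun i j hij => ?_) (fun i => ?_) ?_
  · change inner ℂ _ _ = 0
    rw [inner_indicatorMul_indicatorMul (hB i) (hB j), (disjoint hij).inter_eq, indicatorMul_empty,
      zero_apply, inner_zero_right]
  · rw [inner_indicatorMul_indicatorMul hU (hB i), inter_eq_right.2 (subset_iUnion B i),
      ← inter_self (B i), ← inner_indicatorMul_indicatorMul (hB i) (hB i), inter_self,
      inner_self_eq_norm_sq_to_K, RCLike.ofReal_pow]
  · have additive := measure_iUnion (μ := μ.withDensity fun x => ‖f x‖ₑ ^ 2) disjoint hB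
    simp only [withDensity_enorm_sq_apply hU, withDensity_enorm_sq_apply (hB _)] at additive
    have hasSum_toReal := ENNReal.hasSum_toReal (additive ▸ ENNReal.ofReal_ne_top)
    rw [← ENNReal.tsum_toReal_eq (fun _ => ENNReal.ofReal_ne_top), ← additive] at hasSum_toReal
    simpa only [ENNReal.toReal_ofReal (sq_nonneg _)] using hasSum_toReal

/-- The projection-valued measure `B ↦ 1_B(φ)` of the operator of multiplication by a real function
`φ` on `L²(μ)`. -/
def multiplicationPVM (μ : Measure α) {φ : α → ℝ} (hφ : Measurable φ) :
    ProjectionValuedMeasure (Lp ℂ 2 μ) where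
  proj B := indicatorMul μ (φ ⁻¹' B)
  isStarProjection _ hB := isStarProjection_indicatorMul (hφ hB)
  proj_empty := indicatorMul_empty
  proj_univ := indicatorMul_univ
  proj_inter _ _ hB hC := indicatorMul_inter (hφ hB) (hφ hC)
  hasSum_iUnion B hB disjoint f := by
    rw [preimage_iUnion]
    exact hasSum_indicatorMul_iUnion (fun n => hφ (hB n)) (fun m n h => (disjoint h).preimage φ) f

theorem scalarMeasure_multiplicationPVM {φ : α → ℝ} (hφ : Measurable φ) (f : Lp ℂ 2 μ) :
    (multiplicationPVM μ hφ).scalarMeasure f = (μ.withDensity fun x => ‖f x‖ₑ ^ 2).map φ := by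
  ext B hB
  rw [Measure.map_apply hφ hB, withDensity_enorm_sq_apply (hφ hB),
    ProjectionValuedMeasure.scalarMeasure_apply _ hB]
  rfl

end MultiplicationOperators

theorem memLp_two_iff_lintegral_enorm_sq_lt_top {α F : Type*} [MeasurableSpace α] {μ : Measure α}
    [NormedAddCommGroup F] {g : α → F}
    (hg : AEStronglyMeasurable g μ) : MemLp g 2 μ ↔ ∫⁻ x, ‖g x‖ₑ ^ 2 ∂μ < ∞ := by
  rw [MemLp, eLpNorm_lt_top_iff_lintegral_rpow_enorm_lt_top two_ne_zero ENNReal.ofNat_ne_top]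
  simp only [hg, true_and, ENNReal.toReal_ofNat, ENNReal.rpow_ofNat]

theorem mem_domain_iff_of_mem_graph_iff {H α : Type*} [NormedAddCommGroup H]
    [InnerProductSpace ℂ H] [MeasurableSpace α] {μ : Measure α} {U : H ≃ₗᵢ[ℂ] Lp ℂ 2 μ}
    {φ : α → ℝ} {A : H →ₗ.[ℂ] H}
    (hA : ∀ f g, (f, g) ∈ A.graph ↔ ∀ᵐ x ∂μ, U g x = (φ x : ℂ) * U f x) (f : H) :
    f ∈ A.domain ↔ MemLp (fun x => (φ x : ℂ) * U f x) 2 μ := by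
  rw [LinearPMap.mem_domain_iff]
  constructor
  · rintro ⟨g, hg⟩
    exact (memLp_congr_ae ((hA f g).1 hg)).1 (Lp.memLp (U g))
  · intro h
    refine ⟨U.symm (h.toLp _), (hA _ _).2 ?_⟩
    rw [U.apply_symm_apply]
    exact h.coeFn_toLp

section UnitaryEquivalence

variable {H K : Type*} [NormedAddCommGroup H] [InnerProductSpace ℂ H] [CompleteSpace H]
  [NormedAddCommGroup K] [InnerProductSpace ℂ K] [CompleteSpace K]

namespace ProjectionValuedMeasure

/-- The pullback `B ↦ U⁻¹ E(B) U` of a projection-valued measure along a unitary `U`. -/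
def conj (E : ProjectionValuedMeasure K) (U : H ≃ₗᵢ[ℂ] K) : ProjectionValuedMeasure H where
  proj B := U.symm.conjStarAlgEquiv (E.proj B)
  isStarProjection B hB := (E.isStarProjection B hB).map _
  proj_empty := by rw [E.proj_empty, map_zero]
  proj_univ := by rw [E.proj_univ, map_one]
  proj_inter B B' hB hB' := by rw [E.proj_inter B B' hB hB', map_mul]
  hasSum_iUnion B hB disjoint x :=
    (E.hasSum_iUnion B hB disjoint (U x)).mapL (U.symm : K →L[ℂ] H)

theorem scalarMeasure_conj (E : ProjectionValuedMeasure K) (U : H ≃ₗᵢ[ℂ] K) (x : H) :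
    (E.conj U).scalarMeasure x = E.scalarMeasure (U x) := by
  ext B hB
  rw [scalarMeasure_apply _ hB, scalarMeasure_apply _ hB, conj,
    LinearIsometryEquiv.conjStarAlgEquiv_apply_apply, U.symm.norm_map, U.symm_symm]

end ProjectionValuedMeasure

section Diagonalization

variable {α : Type*} [MeasurableSpace α] {μ : Measure α} {U : H ≃ₗᵢ[ℂ] Lp ℂ 2 μ} {φ : α → ℝ}
  {A : H →ₗ.[ℂ] H}

theorem lintegral_sq_scalarMeasure_multiplicationPVM (hφ : Measurable φ) (f : Lp ℂ 2 μ) :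
    ∫⁻ t, ENNReal.ofReal (t ^ 2) ∂(multiplicationPVM μ hφ).scalarMeasure f =
      ∫⁻ x, ‖(φ x : ℂ) * f x‖ₑ ^ 2 ∂μ := by
  rw [scalarMeasure_multiplicationPVM, lintegral_map (by fun_prop) hφ,
    lintegral_withDensity_eq_lintegral_mul₀
      ((Lp.aestronglyMeasurable f).enorm.pow_const 2) (by fun_prop)]
  refine lintegral_congr fun x => ?_
  rw [Pi.mul_apply, enorm_mul, mul_pow, mul_comm, ← sq_abs, ENNReal.ofReal_pow (abs_nonneg _),
    ← Real.norm_eq_abs, ← Complex.norm_real, ofReal_norm]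

theorem integral_scalarMeasure_multiplicationPVM (hφ : Measurable φ) (f : Lp ℂ 2 μ) :
    ((∫ t, t ∂(multiplicationPVM μ hφ).scalarMeasure f : ℝ) : ℂ) =
      ∫ x, inner ℂ (f x) ((φ x : ℂ) * f x) ∂μ := by
  rw [scalarMeasure_multiplicationPVM, integral_map hφ.aemeasurable (by fun_prop),
    integral_withDensity_eq_integral_toReal_smul₀
      ((Lp.aestronglyMeasurable f).enorm.pow_const 2) (by simp), ← integral_complex_ofReal]
  refine integral_congr_ae (ae_of_all _ fun x => ?_)
  simp only [ENNReal.toReal_pow, toReal_enorm, smul_eq_mul, RCLike.inner_apply, mul_assoc,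
    RCLike.mul_conj]
  push_cast
  exact mul_comm _ _

theorem isSpectralMeasureOf_of_mem_graph_iff (hφ : Measurable φ)
    (hA : ∀ f g, (f, g) ∈ A.graph ↔ ∀ᵐ x ∂μ, U g x = (φ x : ℂ) * U f x) :
    ((multiplicationPVM μ hφ).conj U).IsSpectralMeasureOf A := by
  constructor
  · intro f
    have measurable : AEStronglyMeasurable (fun x => (φ x : ℂ) * U f x) μ :=
      .mul (by fun_prop) (Lp.aestronglyMeasurable (U f))
    rw [ProjectionValuedMeasure.scalarMeasure_conj, lintegral_sq_scalarMeasure_multiplicationPVM,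
      ← memLp_two_iff_lintegral_enorm_sq_lt_top measurable, mem_domain_iff_of_mem_graph_iff hA]
  · intro f
    rw [ProjectionValuedMeasure.scalarMeasure_conj, integral_scalarMeasure_multiplicationPVM,
      ← U.inner_map_map, L2.inner_def]
    refine integral_congr_ae ?_
    filter_upwards [(hA f (A f)).1 (A.mem_graph f)] with x hx
    rw [hx]

theorem spectralProjection_eq_of_mem_graph_iff (hφ : Measurable φ)
    (hA : ∀ f g, (f, g) ∈ A.graph ↔ ∀ᵐ x ∂μ, U g x = (φ x : ℂ) * U f x) {B : Set ℝ}
    (hB : MeasurableSet B) :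
    spectralProjection A B = U.symm.conjStarAlgEquiv (indicatorMul μ (φ ⁻¹' B)) :=
  (isSpectralMeasureOf_of_mem_graph_iff hφ hA).spectralProjection_eq hB

end Diagonalization

theorem spectralProjection_positionOp {B : Set ℝ} (hB : MeasurableSet B) :
    spectralProjection positionOp B = indicatorMul volume B := by
  have diagonal (f g : L2Line) : (f, g) ∈ positionOp.graph ↔ ∀ᵐ x : ℝ,
      LinearIsometryEquiv.refl ℂ L2Line g x = (x : ℂ) * LinearIsometryEquiv.refl ℂ L2Line f x := by
    rw [positionOp_graph]
    rfl
  rw [spectralProjection_eq_of_mem_graph_iff measurable_id diagonal hB]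
  rfl

end UnitaryEquivalence

section TemperedDistributions

theorem derivCLM_eq_lineDerivOp {F : Type*} [NormedAddCommGroup F] [NormedSpace ℂ F]
    (T : 𝓢'(ℝ, F)) : TemperedDistribution.derivCLM F T = LineDeriv.lineDerivOp (1 : ℝ) T := by
  ext φ
  rw [TemperedDistribution.derivCLM_apply_apply, TemperedDistribution.lineDerivOp_apply_apply]
  rfl

variable {E F : Type*} [NormedAddCommGroup E] [MeasurableSpace E] [BorelSpace E]
  [NormedAddCommGroup F] [CompleteSpace F]

theorem ae_eq_of_integral_schwartz_smul_eq [NormedSpace ℝ E] [FiniteDimensional ℝ E]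
    [NormedSpace ℂ F] {μ : Measure E} {f g : E → F} (hf : LocallyIntegrable f μ)
    (hg : LocallyIntegrable g μ) (h : ∀ φ : 𝓢(E, ℂ), ∫ x, φ x • f x ∂μ = ∫ x, φ x • g x ∂μ) :
    f =ᵐ[μ] g := by
  let _ : NormedSpace ℝ F := NormedSpace.restrictScalars ℝ ℂ F
  refine ae_eq_of_integral_contDiff_smul_eq hf hg fun φ smooth support => ?_
  have support_ofReal : HasCompactSupport (Complex.ofRealCLM ∘ φ) := support.comp_left rfl
  exact h (support_ofReal.toSchwartzMap (Complex.ofRealCLM.contDiff.comp smooth))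

section

variable [NormedSpace ℝ E] [NormedSpace ℂ F] {μ : Measure E}
  [μ.HasTemperateGrowth] {p : ℝ≥0∞} [hp : Fact (1 ≤ p)] {m : E → ℂ}

theorem smulLeftCLM_toTemperedDistribution_apply (hm : m.HasTemperateGrowth) (f : Lp F p μ)
    (φ : 𝓢(E, ℂ)) :
    (TemperedDistribution.smulLeftCLM F m (f : 𝓢'(E, F))) φ = ∫ x, φ x • m x • f x ∂μ := by
  rw [TemperedDistribution.smulLeftCLM_apply_apply, Lp.toTemperedDistribution_apply]
  simp only [SchwartzMap.smulLeftCLM_apply_apply hm, smul_smul, smul_eq_mul, mul_comm]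

theorem toTemperedDistribution_eq_smulLeftCLM_iff [FiniteDimensional ℝ E]
    [IsLocallyFiniteMeasure μ] (hm : m.HasTemperateGrowth) (f g : Lp F p μ) :
    (g : 𝓢'(E, F)) = TemperedDistribution.smulLeftCLM F m (f : 𝓢'(E, F)) ↔
      ∀ᵐ x ∂μ, g x = m x • f x := by
  constructor
  · intro h
    have locallyIntegrable : LocallyIntegrable (fun x => m x • f x) μ := by
      have hf := (Lp.memLp f).locallyIntegrable hp.1
      rw [← locallyIntegrableOn_univ] at hf ⊢
      exact hf.continuousOn_smul isOpen_univ.isLocallyClosed hm.1.continuous.continuousOn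
    refine ae_eq_of_integral_schwartz_smul_eq ((Lp.memLp g).locallyIntegrable hp.1)
      locallyIntegrable fun φ => ?_
    rw [← smulLeftCLM_toTemperedDistribution_apply hm, ← h, Lp.toTemperedDistribution_apply]
  · intro h
    ext φ
    rw [smulLeftCLM_toTemperedDistribution_apply hm, Lp.toTemperedDistribution_apply]
    exact integral_congr_ae (h.mono fun x hx => congrArg (φ x • ·) hx)

end

theorem coeFn_fourier_toLp [InnerProductSpace ℝ E] [FiniteDimensional ℝ E]
    [InnerProductSpace ℂ F] {f : E → F} (hf : Integrable f) (hf₂ : MemLp f 2) :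
    (𝓕 (hf₂.toLp f) : Lp F 2 (volume : Measure E)) =ᵐ[volume] 𝓕 f := by
  have continuous : Continuous (𝓕 f) :=
    VectorFourier.fourierIntegral_continuous Real.continuous_fourierChar
      (by exact continuous_inner) hf
  refine ae_eq_of_integral_schwartz_smul_eq ((Lp.memLp _).locallyIntegrable one_le_two)
    continuous.locallyIntegrable fun φ => ?_
  have plancherel : ∫ x, 𝓕 φ x • f x = ∫ ξ, φ ξ • 𝓕 f ξ := by
    have := VectorFourier.integral_fourierIntegral_smul_eq_flip (μ := volume) (ν := volume)
      (L := innerₗ E) Real.continuous_fourierChar continuous_inner φ.integrable hf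
    rwa [flip_innerₗ] at this
  calc ∫ ξ, φ ξ • (𝓕 (hf₂.toLp f) : Lp F 2 (volume : Measure E)) ξ
      = ((𝓕 (hf₂.toLp f) : Lp F 2 (volume : Measure E)) : 𝓢'(E, F)) φ :=
        (Lp.toTemperedDistribution_apply _ φ).symm
    _ = ((hf₂.toLp f : Lp F 2 (volume : Measure E)) : 𝓢'(E, F)) (𝓕 φ) := by
        rw [← Lp.fourier_toTemperedDistribution_eq, TemperedDistribution.fourier_apply]
    _ = ∫ x, 𝓕 φ x • f x := by
        rw [Lp.toTemperedDistribution_apply]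
        exact integral_congr_ae (hf₂.coeFn_toLp.mono fun x hx => congrArg (𝓕 φ x • ·) hx)
    _ = ∫ ξ, φ ξ • 𝓕 f ξ := plancherel

theorem coeFn_fourier_compMeasurePreserving_neg [InnerProductSpace ℝ E]
    [FiniteDimensional ℝ E] [InnerProductSpace ℂ F] {f : E → F}
    (hf : Integrable f) (hf₂ : MemLp f 2) :
    (𝓕 (Lp.compMeasurePreserving Neg.neg (Measure.measurePreserving_neg volume) (hf₂.toLp f)) :
      Lp F 2 (volume : Measure E)) =ᵐ[volume] fun ξ => 𝓕 f (-ξ) := by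
  rw [Lp.toLp_compMeasurePreserving]
  refine (coeFn_fourier_toLp (Integrable.comp_neg hf) _).trans (ae_of_all _ fun ξ => ?_)
  exact (congrFun (Real.fourierInv_eq_fourier_comp_neg f) ξ).symm.trans
    (Real.fourierInv_eq_fourier_neg f ξ)

end TemperedDistributions

section Momentum

theorem mem_momentumGraph_iff (ħ : ℝ) (f g : L2Line) :
    (f, g) ∈ momentumGraph ħ ↔
      ∀ᵐ ξ : ℝ, (𝓕 g : L2Line) ξ = ((2 * Real.pi * ħ * ξ : ℝ) : ℂ) * (𝓕 f : L2Line) ξ := by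
  have temperate : (fun ξ : ℝ => ((inner ℝ ξ 1 : ℝ) : ℂ)).HasTemperateGrowth := by fun_prop
  have multiplier : (fun ξ : ℝ => ((2 * Real.pi * ħ * ξ : ℝ) : ℂ)) =
      (-(Complex.I * ħ) * (2 * Real.pi * Complex.I)) • fun ξ : ℝ => ((inner ℝ ξ 1 : ℝ) : ℂ) := by
    ext ξ
    simp only [Pi.smul_apply, smul_eq_mul, RCLike.inner_apply, conj_trivial, one_mul]
    push_cast
    linear_combination (2 * ħ * Real.pi * ξ : ℂ) * Complex.I_sq
  have fourier_derivative : 𝓕 (-(Complex.I * ħ) •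
      TemperedDistribution.derivCLM ℂ (f : 𝓢'(ℝ, ℂ))) =
        TemperedDistribution.smulLeftCLM ℂ (fun ξ : ℝ => ((2 * Real.pi * ħ * ξ : ℝ) : ℂ))
          ((𝓕 f : L2Line) : 𝓢'(ℝ, ℂ)) := by
    rw [multiplier, TemperedDistribution.smulLeftCLM_smul temperate, derivCLM_eq_lineDerivOp,
      FourierTransform.fourier_smul, TemperedDistribution.fourier_lineDerivOp_eq,
      Lp.fourier_toTemperedDistribution_eq, smul_smul]
    rfl
  calc (f, g) ∈ momentumGraph ħ
      ↔ (g : 𝓢'(ℝ, ℂ)) = -(Complex.I * ħ) • TemperedDistribution.derivCLM ℂ (f : 𝓢'(ℝ, ℂ)) :=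
        Iff.rfl
    _ ↔ 𝓕 (g : 𝓢'(ℝ, ℂ)) =
          𝓕 (-(Complex.I * ħ) • TemperedDistribution.derivCLM ℂ (f : 𝓢'(ℝ, ℂ))) :=
        (FourierTransform.fourierEquiv ℂ 𝓢'(ℝ, ℂ)).injective.eq_iff.symm
    _ ↔ _ := by
      rw [fourier_derivative, Lp.fourier_toTemperedDistribution_eq,
        toTemperedDistribution_eq_smulLeftCLM_iff (by fun_prop)]
      rfl

theorem spectralProjection_momentumOp (ħ : ℝ) {B : Set ℝ} (hB : MeasurableSet B) :
    spectralProjection (momentumOp ħ) B = (Lp.fourierTransformₗᵢ ℝ ℂ).symm.conjStarAlgEquiv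
      (indicatorMul volume ((2 * Real.pi * ħ * ·) ⁻¹' B)) := by
  refine spectralProjection_eq_of_mem_graph_iff (measurable_const_mul _) (fun f g => ?_) hB
  rw [momentumOp_graph]
  exact mem_momentumGraph_iff ħ f g

end Momentum

theorem eqOn_of_analyticOnNhd_of_eventually_eq_ofReal {f g : ℂ → ℂ} {U : Set ℂ}
    (hf : AnalyticOnNhd ℂ f U) (hg : AnalyticOnNhd ℂ g U) (hU : IsPreconnected U) {x : ℝ}
    (hx : (x : ℂ) ∈ U) (h : ∀ᶠ t : ℝ in nhds x, f t = g t) : EqOn f g U := by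
  have tendsto : Filter.Tendsto ((↑) : ℝ → ℂ) (nhdsWithin x {x}ᶜ) (nhdsWithin (x : ℂ) {↑x}ᶜ) :=
    Complex.continuous_ofReal.continuousAt.continuousWithinAt.tendsto_nhdsWithin
      fun t ht => Complex.ofReal_injective.ne ht
  exact hf.eqOn_of_preconnected_of_frequently_eq hg hU hx
    (tendsto.frequently (h.filter_mono nhdsWithin_le_nhds).frequently)

section GammaDistribution

open ProbabilityTheory

variable {a r : ℝ}

theorem integrable_gammaPDFReal (ha : 0 < a) (hr : 0 < r) : Integrable (gammaPDFReal a r) := by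
  refine ⟨by fun_prop, ?_⟩
  rw [hasFiniteIntegral_iff_ofReal (ae_of_all _ (gammaPDFReal_nonneg ha hr))]
  exact (lintegral_gammaPDF_eq_one ha hr).trans_lt ENNReal.one_lt_top

theorem integral_gammaPDFReal (ha : 0 < a) (hr : 0 < r) : ∫ x, gammaPDFReal a r x = 1 := by
  rw [integral_eq_lintegral_of_nonneg_ae (ae_of_all _ (gammaPDFReal_nonneg ha hr)) (by fun_prop)]
  exact (congrArg ENNReal.toReal (lintegral_gammaPDF_eq_one ha hr)).trans ENNReal.toReal_one

theorem exp_mul_gammaPDFReal (hr : 0 < r) {t : ℝ} (ht : t < r) (x : ℝ) :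
    Real.exp (t * x) * gammaPDFReal a r x = (1 - t / r) ^ (-a) * gammaPDFReal a (r - t) x := by
  have hrt : 0 < r - t := sub_pos.2 ht
  rcases lt_or_ge x 0 with hx | hx
  · simp only [gammaPDFReal, if_neg hx.not_ge, mul_zero]
  · have rate : (1 - t / r) ^ (-a) * (r - t) ^ a = r ^ a := by
      rw [one_sub_div hr.ne', Real.rpow_neg (by positivity), Real.div_rpow hrt.le hr.le]
      field_simp
    have exponent : Real.exp (t * x) * Real.exp (-(r * x)) = Real.exp (-((r - t) * x)) := by
      rw [← Real.exp_add]
      ring_nf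
    simp only [gammaPDFReal, if_pos hx]
    rw [← rate, ← exponent]
    ring

theorem gammaPDFReal_sq (ha : 1 / 2 < a) (hr : 0 < r) (x : ℝ) :
    gammaPDFReal a r x ^ 2 = r * Real.Gamma (2 * a - 1) / (Real.Gamma a ^ 2 * 2 ^ (2 * a - 1)) *
      gammaPDFReal (2 * a - 1) (2 * r) x := by
  have hΓ : 0 < Real.Gamma (2 * a - 1) := Real.Gamma_pos_of_pos (by linarith)
  rcases lt_or_ge x 0 with hx | hx
  · simp only [gammaPDFReal, if_neg hx.not_ge, mul_zero, zero_pow two_ne_zero]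
  · have rate : (2 * r) ^ (2 * a - 1) * r = 2 ^ (2 * a - 1) * (r ^ a) ^ 2 := by
      rw [Real.mul_rpow two_pos.le hr.le, mul_assoc, ← Real.rpow_add_one hr.ne',
        ← Real.rpow_mul_natCast hr.le]
      norm_num [mul_comm]
    have power : (x ^ (a - 1)) ^ 2 = x ^ (2 * a - 1 - 1) := by
      rw [← Real.rpow_mul_natCast hx]
      ring_nf
    have exponent : Real.exp (-(r * x)) ^ 2 = Real.exp (-(2 * r * x)) := by
      rw [← Real.exp_nat_mul]
      ring_nf
    simp only [gammaPDFReal, if_pos hx, mul_pow, div_pow, power, exponent]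
    field_simp
    linear_combination (-x ^ (2 * a - 1 - 1)) * rate

theorem memLp_gammaPDFReal (ha : 1 / 2 < a) (hr : 0 < r) :
    MemLp (fun x => (gammaPDFReal a r x : ℂ)) 2 volume := by
  have measurable := (measurable_gammaPDFReal a r).aestronglyMeasurable (μ := volume)
  refine MemLp.ofReal ((memLp_two_iff_integrable_sq measurable).2 ?_)
  simp only [gammaPDFReal_sq ha hr]
  exact (integrable_gammaPDFReal (by linarith) (by positivity)).const_mul _

theorem measurable_gammaPDF (a r : ℝ) : Measurable (gammaPDF a r) :=
  (measurable_gammaPDFReal a r).ennreal_ofReal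

theorem integral_gammaMeasure {F : Type*} [NormedAddCommGroup F] [NormedSpace ℝ F]
    (ha : 0 < a) (hr : 0 < r) (f : ℝ → F) :
    ∫ x, f x ∂gammaMeasure a r = ∫ x, gammaPDFReal a r x • f x := by
  rw [gammaMeasure, integral_withDensity_eq_integral_toReal_smul
    (measurable_gammaPDF a r) (ae_of_all _ fun _ => ENNReal.ofReal_lt_top)]
  simp only [gammaPDF, ENNReal.toReal_ofReal (gammaPDFReal_nonneg ha hr _)]

theorem Iio_subset_integrableExpSet_gammaMeasure (ha : 0 < a) (hr : 0 < r) :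
    Iio r ⊆ integrableExpSet id (gammaMeasure a r) := by
  intro t ht
  rw [integrableExpSet, mem_ofPred_eq, gammaMeasure, integrable_withDensity_iff_integrable_smul'
    (measurable_gammaPDF a r) (ae_of_all _ fun _ => ENNReal.ofReal_lt_top)]
  simp only [gammaPDF, ENNReal.toReal_ofReal (gammaPDFReal_nonneg ha hr _), id, smul_eq_mul,
    mul_comm (gammaPDFReal _ _ _), exp_mul_gammaPDFReal hr ht]
  exact (integrable_gammaPDFReal ha (sub_pos.2 ht)).const_mul _

theorem mgf_gammaMeasure (ha : 0 < a) (hr : 0 < r) {t : ℝ} (ht : t < r) :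
    mgf id (gammaMeasure a r) t = (1 - t / r) ^ (-a) := by
  rw [mgf, integral_gammaMeasure ha hr]
  simp only [id, smul_eq_mul, mul_comm (gammaPDFReal _ _ _), exp_mul_gammaPDFReal hr ht]
  rw [integral_const_mul, integral_gammaPDFReal ha (sub_pos.2 ht), mul_one]

theorem complexMGF_gammaMeasure (ha : 0 < a) (hr : 0 < r) {z : ℂ} (hz : z.re < r) :
    complexMGF id (gammaMeasure a r) z = (1 - z / r) ^ (-a : ℂ) := by
  have re_pos {w : ℂ} (hw : w.re < r) : 0 < (1 - w / r).re := by
    rw [Complex.sub_re, Complex.one_re, Complex.div_ofReal_re]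
    exact sub_pos.2 ((div_lt_one hr).2 hw)
  have analytic_left : AnalyticOnNhd ℂ (complexMGF id (gammaMeasure a r)) {w | w.re < r} :=
    fun w hw => analyticAt_complexMGF
      (interior_maximal (Iio_subset_integrableExpSet_gammaMeasure ha hr) isOpen_Iio hw)
  have analytic_right : AnalyticOnNhd ℂ (fun w : ℂ => (1 - w / r) ^ (-a : ℂ)) {w | w.re < r} :=
    fun w hw => AnalyticAt.cpow (by fun_prop) analyticAt_const (Or.inl (re_pos hw))
  have eventually_eq : ∀ᶠ t : ℝ in nhds 0,
      complexMGF id (gammaMeasure a r) t = (1 - (t : ℂ) / r) ^ (-a : ℂ) := by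
    filter_upwards [Iio_mem_nhds hr] with t ht
    have nonneg : 0 ≤ 1 - t / r := by simpa using (re_pos (w := t) (by simpa using ht)).le
    rw [complexMGF_ofReal, mgf_gammaMeasure ha hr ht, Complex.ofReal_cpow nonneg]
    push_cast
    rfl
  exact eqOn_of_analyticOnNhd_of_eventually_eq_ofReal analytic_left analytic_right
    (convex_halfSpace_re_lt r).isPreconnected (x := 0) (by simpa using hr) eventually_eq hz

theorem fourier_gammaPDFReal (ha : 0 < a) (hr : 0 < r) (ξ : ℝ) :
    𝓕 (fun x => (gammaPDFReal a r x : ℂ)) ξ = (1 + 2 * Real.pi * ξ / r * Complex.I) ^ (-a : ℂ) := by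
  calc 𝓕 (fun x => (gammaPDFReal a r x : ℂ)) ξ
      = ∫ x, gammaPDFReal a r x • Complex.exp (-(2 * Real.pi * ξ * Complex.I) * x) := by
        rw [Real.fourier_eq']
        refine integral_congr_ae (ae_of_all _ fun x => ?_)
        simp only [smul_eq_mul, Complex.real_smul, RCLike.inner_apply, conj_trivial]
        push_cast
        ring_nf
    _ = complexMGF id (gammaMeasure a r) (-(2 * Real.pi * ξ * Complex.I)) :=
        (integral_gammaMeasure ha hr _).symm
    _ = (1 + 2 * Real.pi * ξ / r * Complex.I) ^ (-a : ℂ) := by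
        rw [complexMGF_gammaMeasure ha hr (by simpa using hr)]
        ring_nf

end GammaDistribution

section HalfLineIntegral

theorem one_sub_mul_I_mem_slitPlane (ξ : ℝ) : 1 - ξ * Complex.I ∈ Complex.slitPlane :=
  Or.inl (by simp)

theorem norm_one_sub_mul_I_cpow (s ξ : ℝ) :
    ‖(1 - ξ * Complex.I) ^ (-s : ℂ)‖ = (1 + ‖ξ‖ ^ 2) ^ (-s / 2) := by
  have norm_eq : ‖1 - ξ * Complex.I‖ = (1 + ‖ξ‖ ^ 2) ^ (1 / 2 : ℝ) := by
    rw [Complex.norm_eq_sqrt_sq_add_sq, Real.sqrt_eq_rpow]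
    simp
  rw [← Complex.ofReal_neg, Complex.norm_cpow_real, norm_eq, ← Real.rpow_mul (by positivity)]
  ring_nf

theorem continuous_one_sub_mul_I_cpow (z : ℂ) :
    Continuous fun ξ : ℝ => (1 - ξ * Complex.I) ^ z :=
  Continuous.cpow (by fun_prop) continuous_const one_sub_mul_I_mem_slitPlane

theorem integrable_one_sub_mul_I_cpow {s : ℝ} (hs : 1 < s) :
    Integrable fun ξ : ℝ => (1 - ξ * Complex.I) ^ (-s : ℂ) := by
  have integrable_norm : Integrable fun ξ : ℝ => (1 + ‖ξ‖ ^ 2) ^ (-s / 2) :=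
    integrable_rpow_neg_one_add_norm_sq (by simpa using hs)
  exact integrable_norm.mono' (continuous_one_sub_mul_I_cpow _).aestronglyMeasurable
    (ae_of_all _ fun ξ => (norm_one_sub_mul_I_cpow s ξ).le)

theorem hasDerivAt_one_sub_mul_I_cpow (z : ℂ) (ξ : ℝ) :
    HasDerivAt (fun ξ : ℝ => (1 - ξ * Complex.I) ^ z)
      (-(z * Complex.I) * (1 - ξ * Complex.I) ^ (z - 1)) ξ := by
  have inner_deriv : HasDerivAt (fun w : ℂ => 1 - w * Complex.I) (-Complex.I) ξ := by
    simpa using ((hasDerivAt_id (ξ : ℂ)).mul_const Complex.I).const_sub 1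
  refine (inner_deriv.cpow_const (one_sub_mul_I_mem_slitPlane ξ)).comp_ofReal.congr_deriv ?_
  ring

theorem tendsto_one_sub_mul_I_cpow {s : ℝ} (hs : 0 < s) :
    Filter.Tendsto (fun ξ : ℝ => (1 - ξ * Complex.I) ^ (-s : ℂ)) Filter.atTop (nhds 0) := by
  rw [tendsto_zero_iff_norm_tendsto_zero]
  simp only [norm_one_sub_mul_I_cpow, neg_div]
  refine (tendsto_rpow_neg_atTop (half_pos hs)).comp (Filter.tendsto_atTop_mono (fun ξ => ?_)
    Filter.tendsto_id)
  rw [id, Real.norm_eq_abs, sq_abs]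
  nlinarith [sq_nonneg (ξ - 1)]

theorem integral_Ioi_one_sub_mul_I_cpow {s : ℝ} (hs : 1 < s) :
    ∫ ξ : ℝ in Ioi 0, (1 - ξ * Complex.I) ^ (-s : ℂ) = Complex.I / (s - 1) := by
  have hs' : (s - 1 : ℂ) ≠ 0 := by exact_mod_cast (sub_pos.2 hs).ne'
  have antideriv (ξ : ℝ) : HasDerivAt
      (fun ξ : ℝ => (1 - ξ * Complex.I) ^ (-(s - 1 : ℝ) : ℂ) / ((s - 1) * Complex.I))
      ((1 - ξ * Complex.I) ^ (-s : ℂ)) ξ := by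
    refine ((hasDerivAt_one_sub_mul_I_cpow (-(s - 1 : ℝ)) ξ).div_const _).congr_deriv ?_
    rw [show (-(s - 1 : ℝ) - 1 : ℂ) = -s by push_cast; ring]
    push_cast
    field_simp [Complex.I_ne_zero]
  rw [integral_Ioi_of_hasDerivAt_of_tendsto' (fun ξ _ => antideriv ξ)
    (integrable_one_sub_mul_I_cpow hs).integrableOn
    ((tendsto_one_sub_mul_I_cpow (sub_pos.2 hs)).div_const _)]
  simp only [Complex.ofReal_zero, zero_mul, sub_zero, Complex.one_cpow, zero_div, zero_sub]
  field_simp [Complex.I_ne_zero]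
  exact Complex.I_sq.symm

theorem inner_one_add_mul_I_cpow (a ξ : ℝ) :
    inner ℂ ((1 + ξ * Complex.I) ^ (-a : ℂ)) ((1 - ξ * Complex.I) ^ (-a : ℂ)) =
      (1 - ξ * Complex.I) ^ (-(2 * a : ℝ) : ℂ) := by
  have conj_base : (starRingEnd ℂ) (1 - ξ * Complex.I) = 1 + ξ * Complex.I := by
    simp [sub_eq_add_neg]
  have conj_cpow : (starRingEnd ℂ) ((1 + ξ * Complex.I) ^ (-a : ℂ)) =
      (1 - ξ * Complex.I) ^ (-a : ℂ) := by
    rw [← conj_base, Complex.conj_cpow _ _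
      (Complex.slitPlane_arg_ne_pi (one_sub_mul_I_mem_slitPlane ξ)), RCLike.conj_conj, map_neg,
      Complex.conj_ofReal]
  rw [RCLike.inner_apply, conj_cpow,
    ← Complex.cpow_add _ _ (Complex.slitPlane_ne_zero (one_sub_mul_I_mem_slitPlane ξ))]
  push_cast
  ring_nf

end HalfLineIntegral

section HalfLineCommutator

open ProbabilityTheory

/-- The projection `𝓕⁻¹ 1_{(0,∞)} 𝓕` of `L²(ℝ)` onto the Hardy space of functions with Fourier
transform supported in the positive half-line. -/
def hardyProjection : L2Line →L[ℂ] L2Line :=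
  (Lp.fourierTransformₗᵢ ℝ ℂ).symm.conjStarAlgEquiv (indicatorMul volume (Ioi 0))

theorem isStarProjection_hardyProjection : IsStarProjection hardyProjection :=
  (isStarProjection_indicatorMul measurableSet_Ioi).map
    (Lp.fourierTransformₗᵢ ℝ ℂ).symm.conjStarAlgEquiv

theorem inner_hardyProjection (f g : L2Line) : inner ℂ f (hardyProjection g) =
    ∫ ξ in Ioi 0, inner ℂ ((𝓕 f : L2Line) ξ) ((𝓕 g : L2Line) ξ) := by
  have fourier_hardyProjection :
      Lp.fourierTransformₗᵢ ℝ ℂ (hardyProjection g) = indicatorMul volume (Ioi 0) (𝓕 g) :=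
    (Lp.fourierTransformₗᵢ ℝ ℂ).apply_symm_apply _
  rw [← (Lp.fourierTransformₗᵢ ℝ ℂ).inner_map_map, fourier_hardyProjection,
    inner_indicatorMul measurableSet_Ioi]
  rfl

theorem spectralProjection_momentumOp_Ioi {ħ : ℝ} (hħ : 0 < ħ) :
    spectralProjection (momentumOp ħ) (Ioi 0) = hardyProjection := by
  rw [spectralProjection_momentumOp ħ measurableSet_Ioi, hardyProjection,
    preimage_const_mul_Ioi₀ _ (by positivity), zero_div]

/-- The commutator of the projections of `L²(ℝ)` onto functions supported in the positive half-line
and onto functions with Fourier transform supported there. -/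
def halfLineCommutator : L2Line →L[ℂ] L2Line :=
  ⁅indicatorMul volume (Ioi (0 : ℝ)), hardyProjection⁆

theorem lineCommutator_eq_halfLineCommutator {ħ : ℝ} (hħ : 0 < ħ) :
    lineCommutator ħ = halfLineCommutator := by
  rw [lineCommutator, spectralProjection_positionOp measurableSet_Ioi,
    spectralProjection_momentumOp_Ioi hħ, halfLineCommutator]

variable {a : ℝ}

/-- The test vector `x ↦ (2π)ᵃ xᵃ⁻¹ e^{-2πx} / Γ(a)` on the positive half-line; the rate `2π` makes
its Fourier transform `(1 + iξ)⁻ᵃ`. -/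
def gammaVector (ha : 1 / 2 < a) : L2Line :=
  (memLp_gammaPDFReal ha Real.two_pi_pos).toLp _

/-- The reflection `x ↦ f (-x)` of the test vector `f = gammaVector ha`. -/
def reflectedGammaVector (ha : 1 / 2 < a) : L2Line :=
  Lp.compMeasurePreserving Neg.neg (Measure.measurePreserving_neg volume) (gammaVector ha)

theorem norm_reflectedGammaVector (ha : 1 / 2 < a) :
    ‖reflectedGammaVector ha‖ = ‖gammaVector ha‖ :=
  Lp.norm_compMeasurePreserving _ _

theorem norm_gammaVector_sq (ha : 1 / 2 < a) : ‖gammaVector ha‖ ^ 2 =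
    2 * Real.pi * Real.Gamma (2 * a - 1) / (Real.Gamma a ^ 2 * 2 ^ (2 * a - 1)) := by
  rw [gammaVector, norm_sq_toLp]
  simp only [Complex.norm_real, Real.norm_eq_abs, sq_abs, gammaPDFReal_sq ha Real.two_pi_pos]
  rw [integral_const_mul, integral_gammaPDFReal (by linarith) (by positivity), mul_one]

theorem gammaVector_eq_zero_of_neg (ha : 1 / 2 < a) :
    ∀ᵐ x : ℝ, x < 0 → gammaVector ha x = 0 := by
  filter_upwards [(memLp_gammaPDFReal ha Real.two_pi_pos).coeFn_toLp] with x hx hneg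
  rw [gammaVector, hx, gammaPDFReal, if_neg hneg.not_ge, Complex.ofReal_zero]

theorem indicatorMul_gammaVector (ha : 1 / 2 < a) :
    indicatorMul volume (Ioi 0) (gammaVector ha) = gammaVector ha := by
  refine indicatorMul_eq_self measurableSet_Ioi ?_
  filter_upwards [gammaVector_eq_zero_of_neg ha, Measure.ae_ne volume 0] with x hx hne hmem
  exact hx (lt_of_le_of_ne (not_lt.1 hmem) hne)

theorem indicatorMul_reflectedGammaVector (ha : 1 / 2 < a) :
    indicatorMul volume (Ioi 0) (reflectedGammaVector ha) = 0 := by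
  have reflection := Measure.measurePreserving_neg (volume : Measure ℝ)
  refine indicatorMul_eq_zero measurableSet_Ioi ?_
  filter_upwards [Lp.coeFn_compMeasurePreserving (gammaVector ha) reflection,
    reflection.quasiMeasurePreserving.ae (gammaVector_eq_zero_of_neg ha)] with x hx h0 hmem
  rw [reflectedGammaVector, hx]
  exact h0 (neg_neg_of_pos hmem)

theorem coeFn_fourier_gammaVector (ha : 1 / 2 < a) :
    (𝓕 (gammaVector ha) : L2Line) =ᵐ[volume] fun ξ : ℝ => (1 + ξ * Complex.I) ^ (-a : ℂ) := by
  have ha₀ : 0 < a := by linarith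
  refine (coeFn_fourier_toLp (integrable_gammaPDFReal ha₀ Real.two_pi_pos).ofReal
    (memLp_gammaPDFReal ha Real.two_pi_pos)).trans (ae_of_all _ fun ξ => ?_)
  rw [fourier_gammaPDFReal ha₀ Real.two_pi_pos]
  have : (Real.pi : ℂ) ≠ 0 := by exact_mod_cast Real.pi_ne_zero
  push_cast
  field_simp

theorem coeFn_fourier_reflectedGammaVector (ha : 1 / 2 < a) :
    (𝓕 (reflectedGammaVector ha) : L2Line) =ᵐ[volume]
      fun ξ : ℝ => (1 - ξ * Complex.I) ^ (-a : ℂ) := by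
  have ha₀ : 0 < a := by linarith
  refine (coeFn_fourier_compMeasurePreserving_neg
    (integrable_gammaPDFReal ha₀ Real.two_pi_pos).ofReal
    (memLp_gammaPDFReal ha Real.two_pi_pos)).trans (ae_of_all _ fun ξ => ?_)
  have : (Real.pi : ℂ) ≠ 0 := by exact_mod_cast Real.pi_ne_zero
  simp only [fourier_gammaPDFReal ha₀ Real.two_pi_pos]
  push_cast
  field_simp
  ring_nf

theorem inner_gammaVector_hardyProjection (ha : 1 / 2 < a) :
    inner ℂ (gammaVector ha) (hardyProjection (reflectedGammaVector ha)) =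
      Complex.I / ((2 * a : ℝ) - 1) := by
  rw [inner_hardyProjection, ← integral_Ioi_one_sub_mul_I_cpow (by linarith)]
  refine integral_congr_ae (ae_restrict_of_ae ?_)
  filter_upwards [coeFn_fourier_gammaVector ha, coeFn_fourier_reflectedGammaVector ha]
    with ξ hu hv
  rw [hu, hv, inner_one_add_mul_I_cpow]

theorem Gamma_sq_mul_two_rpow_le (ha : 1 / 2 < a) :
    Real.Gamma a ^ 2 * 2 ^ (2 * a - 1) ≤
      ‖halfLineCommutator‖ * (2 * Real.pi * Real.Gamma (2 * a)) := by
  have pos : 0 < 2 * a - 1 := by linarith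
  have : 0 < Real.Gamma a := Real.Gamma_pos_of_pos (by linarith)
  have coefficient_le := norm_inner_le_norm_lie
    (isStarProjection_indicatorMul measurableSet_Ioi).isSelfAdjoint hardyProjection
    (indicatorMul_gammaVector ha) (indicatorMul_reflectedGammaVector ha)
  rw [inner_gammaVector_hardyProjection, norm_reflectedGammaVector, ← sq, norm_gammaVector_sq,
    norm_div, Complex.norm_I, ← Complex.ofReal_one, ← Complex.ofReal_sub,
    Complex.norm_of_nonneg pos.le, ← mul_div_assoc,
    div_le_div_iff₀ pos (by positivity), one_mul] at coefficient_le
  have Gamma_two_mul : Real.Gamma (2 * a) = (2 * a - 1) * Real.Gamma (2 * a - 1) := by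
    rw [← Real.Gamma_add_one pos.ne', sub_add_cancel]
  calc Real.Gamma a ^ 2 * 2 ^ (2 * a - 1) ≤ _ := coefficient_le
    _ = ‖halfLineCommutator‖ * (2 * Real.pi * Real.Gamma (2 * a)) := by
      rw [Gamma_two_mul, halfLineCommutator]
      ring

theorem half_le_norm_halfLineCommutator : 1 / 2 ≤ ‖halfLineCommutator‖ := by
  have continuousAt_Gamma {s : ℝ} (hs : 0 < s) : ContinuousAt Real.Gamma s :=
    (Real.differentiableOn_Gamma_Ioi.differentiableAt (Ioi_mem_nhds hs)).continuousAt
  have continuousAt_left : ContinuousAt (fun a : ℝ => Real.Gamma a ^ 2 * 2 ^ (2 * a - 1)) (1 / 2) :=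
    ((continuousAt_Gamma one_half_pos).pow 2).mul
      (ContinuousAt.rpow (by fun_prop) (by fun_prop) (Or.inl two_ne_zero))
  have continuousAt_right : ContinuousAt
      (fun a : ℝ => ‖halfLineCommutator‖ * (2 * Real.pi * Real.Gamma (2 * a))) (1 / 2) := by
    have := continuousAt_Gamma (s := 2 * (1 / 2)) (by norm_num)
    fun_prop
  have limit_le := le_of_tendsto_of_tendsto
    (continuousAt_left.tendsto.mono_left (nhdsWithin_le_nhds (s := Ioi (1 / 2))))
    (continuousAt_right.tendsto.mono_left nhdsWithin_le_nhds)
    (Filter.mem_of_superset self_mem_nhdsWithin fun _ => Gamma_sq_mul_two_rpow_le)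
  rw [Real.Gamma_one_half_eq, Real.sq_sqrt Real.pi_pos.le, mul_one_div_cancel two_ne_zero,
    sub_self, Real.rpow_zero, Real.Gamma_one] at limit_le
  nlinarith [Real.pi_pos]

theorem norm_halfLineCommutator : ‖halfLineCommutator‖ = 1 / 2 :=
  le_antisymm
    (norm_lie_le_half_of_isStarProjection (isStarProjection_indicatorMul measurableSet_Ioi)
      isStarProjection_hardyProjection)
    half_le_norm_halfLineCommutator

end HalfLineCommutator

end

theorem mainTheorem6 :
    ∃ C : L2Line →L[ℂ] L2Line, (∀ hbar : ℝ, 0 < hbar → lineCommutator hbar = C) ∧ ‖C‖ = 1 / 2 :=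
  ⟨halfLineCommutator, fun _ => lineCommutator_eq_halfLineCommutator, norm_halfLineCommutator⟩
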